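/- Let $p$ be a prime, let $X$ be an arbitrary set and let $F$ be a free pro-$p$ group on $X$: a pro-$p$ group with a map $\iota\colon X\to F$ converging to $1$ (each neighbourhood of $1$ contains $\iota(x)$ for all but finitely many $x\in X$), such that for every pro-$p$ group $P$, every map $X\to P$ converging to $1$ extends uniquely along $\iota$ to a continuous homomorphism $F\to P$. Let $$H^\bullet(F,\mathbb F_p)=\bigoplus_{n\ge 0}H^n(F,\mathbb F_p)$$ be the continuous cohomology of $F$ with coefficients in the discrete trivial module $\mathbb F_p$, regarded as a graded $\mathbb F_p$-algebra under the cup product. Then $H^\bullet(F,\mathbb F_p)$ is asymptotically universally Koszul. Here, for a field $k$ and a connected graded $k$-algebra $A=\bigoplus_{n\ge0}A_n$ (so $A_0=k$) generated in degree $1$: * $A$ is *quadratic* if $A\cong T(A_1)/\langle R\rangle$ for a subspace $R\subseteq A_1\otimes_k A_1$. * If $A$ is quadratic, let $\mathcal L(A)$ be the set of graded left ideals $I$ of $A$ with $I=A\,I_1$, where $I_1=I\cap A_1$. A quadratic algebra $A$ with $\dim_k A_1<\infty$ is *universally Koszul* if for all $I\in\mathcal L(A)$ and $x\in A_1\setminus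 I_1$, the colon ideal $I:x=\{a\in A\mid ax\in I\}$ belongs to $\mathcal L(A)$. * $A$ is *asymptotically universally Koszul* if there is a filtered system $(A_i)_{i\in I}$ of quadratic graded subalgebras of $A$ (with the inclusions as transition maps), such that each $A_i$ is generated in degree $1$ with $\dim_k(A_i)_1<\infty$, each $A_i$ is universally Koszul, the natural map $\varinjlim_{i\in I}A_i\to A$ is an isomorphism of graded algebras, and every finite-dimensional subspace of $A_1$ is contained in some $(A_i)_1$. -/

import Mathlib

open Filter Topology DirectSum TensorProduct

universe u

set_option linter.unusedSectionVars false

namespace ModPCohomology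

section Cochains

variable (p : ℕ) (G : Type u) [Group G] [TopologicalSpace G]

/-- Continuous inhomogeneous `n`-cochains of `G` with values in the discrete trivial `G`-module
`𝔽_p`. -/
abbrev Cochain (n : ℕ) : Type _ := C(Fin n → G, ZMod p)

variable {G} in
theorem continuous_contractNth [IsTopologicalGroup G] {n : ℕ} (j : Fin (n + 1)) :
    Continuous fun x : Fin (n + 1) → G => Fin.contractNth j (· * ·) x := by
  refine continuous_pi fun k => ?_
  unfold Fin.contractNth
  split_ifs <;> fun_prop

variable [IsTopologicalGroup G]

/-- The inhomogeneous differential (for the trivial action):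
`(d f)(g₀, …, gₙ) = f(g₁, …, gₙ) + ∑_{j < n} (-1)^(j+1) f(…, gⱼ gⱼ₊₁, …)
  + (-1)^(n+1) f(g₀, …, gₙ₋₁)`.
The last summand is the one with index `j = n` in the sum below. -/
def d (n : ℕ) : Cochain p G n →ₗ[ZMod p] Cochain p G (n + 1) where
  toFun f :=
    { toFun := fun x => f (fun i => x i.succ) +
        ∑ j : Fin (n + 1), (-1 : ZMod p) ^ ((j : ℕ) + 1) * f (Fin.contractNth j (· * ·) x)
      continuous_toFun := by
        refine Continuous.add (by fun_prop) (continuous_finsetSum _ fun j _ => ?_)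
        exact continuous_const.mul (f.continuous.comp (continuous_contractNth j)) }
  map_add' f g := by
    ext x
    simp only [ContinuousMap.add_apply, ContinuousMap.coe_mk, mul_add, Finset.sum_add_distrib]
    ring
  map_smul' c f := by
    ext x
    simp only [ContinuousMap.smul_apply, ContinuousMap.coe_mk, smul_eq_mul, RingHom.id_apply,
      mul_add, Finset.mul_sum]
    congr 1
    exact Finset.sum_congr rfl fun j _ => by ring

variable {p G}

theorem d_apply {n : ℕ} (f : Cochain p G n) (x : Fin (n + 1) → G) :
    d p G n f x = f (fun i => x i.succ) +
      ∑ j : Fin (n + 1), (-1 : ZMod p) ^ ((j : ℕ) + 1) * f (Fin.contractNth j (· * ·) x) := rfl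

theorem d_d {n : ℕ} (f : Cochain p G n) : d p G (n + 1) (d p G n f) = 0 := by
  let k' := ULift.{u} (ZMod p)
  let F : (Fin n → G) → k' := fun x => ULift.up (f x)
  have h := (groupCohomology.inhomogeneousCochains (Rep.trivial k' G k')).d_comp_d n (n + 1) (n + 1 + 1)
  simp only [CochainComplex.of_d] at h
  have h2 := congrArg (fun φ => φ.hom F) h
  ext x
  have h3 := congrArg (ULift.ringEquiv : k' ≃+* ZMod p) (congrFun h2 x)
  simp only [ModuleCat.hom_comp, LinearMap.comp_apply, inhomogeneousCochains.d_hom_apply, map_add,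
    map_sum, smul_eq_mul, map_mul, map_pow, map_neg, map_one] at h3
  simp only [d_apply, ContinuousMap.zero_apply]
  exact h3

/-- The cup product of cochains (coefficients multiply in `𝔽_p`):
`(f ∪ g)(x₁, …, xₙ₊ₘ) = f(x₁, …, xₙ) g(xₙ₊₁, …, xₙ₊ₘ)`. -/
def cup {n m : ℕ} (f : Cochain p G n) (g : Cochain p G m) : Cochain p G (n + m) where
  toFun x := f (fun i => x (Fin.castAdd m i)) * g (fun i => x (Fin.natAdd n i))
  continuous_toFun := by fun_prop

theorem cup_apply {n m : ℕ} (f : Cochain p G n) (g : Cochain p G m) (x : Fin (n + m) → G) :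
    cup f g x = f (fun i => x (Fin.castAdd m i)) * g (fun i => x (Fin.natAdd n i)) := rfl

/-- The Leibniz rule `d(f ∪ g) = df ∪ g + (-1)ⁿ f ∪ dg`, written out on arguments. -/
theorem d_cup {n m : ℕ} (f : Cochain p G n) (g : Cochain p G m) (x : Fin (n + m + 1) → G) :
    d p G (n + m) (cup f g) x =
      d p G n f (fun i => x ⟨i, by omega⟩) * g (fun i => x ⟨n + 1 + i, by omega⟩) +
      (-1) ^ n * (f (fun i => x ⟨i, by omega⟩) * d p G m g (fun i => x ⟨n + i, by omega⟩)) := by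
  have hsum : ∑ j : Fin (n + m + 1), (-1 : ZMod p) ^ ((j : ℕ) + 1) *
      cup f g (Fin.contractNth j (· * ·) x) =
      (∑ j : Fin n, (-1 : ZMod p) ^ ((j : ℕ) + 1) *
        (f (Fin.contractNth j.castSucc (· * ·) (fun i : Fin (n + 1) => x ⟨i, by omega⟩)) *
          g (fun i => x ⟨n + 1 + i, by omega⟩))) +
      ∑ j : Fin (m + 1), (-1 : ZMod p) ^ (n + (j : ℕ) + 1) *
        (f (fun i => x ⟨i, by omega⟩) *
          g (Fin.contractNth j (· * ·) (fun i : Fin (m + 1) => x ⟨n + i, by omega⟩))) := by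
    have := Fin.sum_univ_add (a := n) (b := m + 1) (fun j => (-1 : ZMod p) ^ ((j : ℕ) + 1) *
      cup f g (Fin.contractNth (n := n + m) j (· * ·) x))
    refine this.trans ?_
    congr 1
    · refine Finset.sum_congr rfl fun j _ => ?_
      have hj := j.2
      rw [cup_apply]
      have hf : (fun i => Fin.contractNth (n := n + m) (Fin.castAdd (m + 1) j) (· * ·) x
          (Fin.castAdd m i)) = Fin.contractNth j.castSucc (· * ·)
            (fun i : Fin (n + 1) => x ⟨i, by omega⟩) := rfl
      have hg : (fun i => Fin.contractNth (n := n + m) (Fin.castAdd (m + 1) j) (· * ·) x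
          (Fin.natAdd n i)) = fun i : Fin m => x ⟨n + 1 + i, by omega⟩ := by
        funext i
        simp only [Fin.contractNth, Fin.val_natAdd, Fin.val_castAdd]
        rw [if_neg (by omega), if_neg (by omega)]
        congr 1
        ext
        simp
        omega
      rw [hf, hg]
      rfl
    · refine Finset.sum_congr rfl fun j _ => ?_
      rw [cup_apply]
      congr 3
      · ext i
        have hi := i.2
        simp [Fin.contractNth]
        rw [if_pos (by omega)]
        rfl
      · ext i
        simp [Fin.contractNth]
        rfl
  rw [d_apply, hsum, d_apply, d_apply, Fin.sum_univ_castSucc (n := n)]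
  have h1 : Fin.contractNth (Fin.last n) (· * ·) (fun i : Fin (n + 1) => x ⟨i, by omega⟩) =
      fun i : Fin n => x ⟨i, by omega⟩ := by
    ext i
    simp [Fin.contractNth]
  have h2 : (fun i : Fin m => x ⟨n + (i.succ : Fin (m + 1)), by have := i.2; simp⟩) =
      fun i : Fin m => x ⟨n + 1 + i, by omega⟩ :=
    funext fun i => congrArg x (Fin.ext (by simp; omega))
  have h3 : cup f g (fun i => x i.succ) =
      f (fun i : Fin n => x ⟨(i.succ : Fin (n + 1)), by have := i.2; simp; omega⟩) *
        g (fun i => x ⟨n + 1 + i, by omega⟩) := by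
    rw [cup_apply]
    congr 2
  rw [h1, h2, h3]
  simp only [Fin.val_last, Fin.val_castSucc, mul_add, add_mul, Finset.sum_mul, Finset.mul_sum,
    pow_add, pow_one]
  have key : ∀ {a b c b' c' e s t : ZMod p}, b = b' → c = c' →
      a + (b + c) = a + (b' + e * -1 * s * t) + (e * (s * t) + c') := by
    rintro a b c _ _ e s t rfl rfl
    ring
  exact key (Finset.sum_congr rfl fun _ _ => by ring) (Finset.sum_congr rfl fun _ _ => by ring)

end Cochains

section Cohomology

variable (p : ℕ) (G : Type u) [Group G] [TopologicalSpace G] [IsTopologicalGroup G]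

/-- Continuous `n`-cocycles. -/
def cocycles (n : ℕ) : Submodule (ZMod p) (Cochain p G n) := LinearMap.ker (d p G n)

/-- Continuous `n`-coboundaries, as a subspace of the `n`-cocycles: the image of the differential
from degree `n - 1`, and `0` if `n = 0`. -/
def coboundaries : (n : ℕ) → Submodule (ZMod p) (cocycles p G n)
  | 0 => ⊥
  | n + 1 => LinearMap.range
      ((d p G n).codRestrict (cocycles p G (n + 1)) fun f => LinearMap.mem_ker.2 (d_d f))

/-- Continuous cohomology `Hⁿ(G, 𝔽_p)`. -/
def H (n : ℕ) : Type u := cocycles p G n ⧸ coboundaries p G n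

instance (n : ℕ) : AddCommGroup (H p G n) :=
  inferInstanceAs (AddCommGroup (cocycles p G n ⧸ coboundaries p G n))

instance (n : ℕ) : Module (ZMod p) (H p G n) :=
  inferInstanceAs (Module (ZMod p) (cocycles p G n ⧸ coboundaries p G n))

variable {p G}

theorem mem_coboundaries_of {m n : ℕ} (h : m + 1 = n) (f : cocycles p G n) (c : Cochain p G m)
    (hc : ∀ x : Fin n → G, f.1 x = d p G m c (fun i => x (Fin.cast h i))) :
    f ∈ coboundaries p G n := by
  subst h
  exact ⟨c, Subtype.ext (ContinuousMap.ext fun x => (hc x).symm)⟩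

/-- The cup product of cocycles. -/
def cupZ {n m : ℕ} : cocycles p G n →ₗ[ZMod p] cocycles p G m →ₗ[ZMod p] cocycles p G (n + m) :=
  LinearMap.mk₂ (ZMod p)
    (fun f g => ⟨cup f.1 g.1, by
      have hf : d p G n f.1 = 0 := f.2
      have hg : d p G m g.1 = 0 := g.2
      refine LinearMap.mem_ker.2 (ContinuousMap.ext fun x => ?_)
      rw [d_cup, hf, hg]
      simp⟩)
    (fun f f' g => Subtype.ext (ContinuousMap.ext fun x => by simp [cup_apply, add_mul]))
    (fun c f g => Subtype.ext (ContinuousMap.ext fun x => by simp [cup_apply, mul_assoc]))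
    (fun f g g' => Subtype.ext (ContinuousMap.ext fun x => by simp [cup_apply, mul_add]))
    (fun c f g => Subtype.ext (ContinuousMap.ext fun x => by simp [cup_apply, mul_left_comm]))

theorem cupZ_coe {n m : ℕ} (f : cocycles p G n) (g : cocycles p G m) :
    (cupZ f g : Cochain p G (n + m)) = cup f.1 g.1 := rfl

theorem cupZ_mem_left {n m : ℕ} (f : cocycles p G n) (g : cocycles p G m)
    (hf : f ∈ coboundaries p G n) : cupZ f g ∈ coboundaries p G (n + m) := by
  cases n with
  | zero =>
    have : f = 0 := hf
    rw [this, map_zero, LinearMap.zero_apply]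
    exact zero_mem _
  | succ n =>
    obtain ⟨c, rfl⟩ := hf
    have hg : d p G m g.1 = 0 := g.2
    refine mem_coboundaries_of (m := n + m) (by omega) _ (cup c g.1) fun x => ?_
    rw [d_cup, hg, cupZ_coe, cup_apply]
    simp
    rfl

theorem cupZ_mem_right {n m : ℕ} (f : cocycles p G n) (g : cocycles p G m)
    (hg : g ∈ coboundaries p G m) : cupZ f g ∈ coboundaries p G (n + m) := by
  cases m with
  | zero =>
    have : g = 0 := hg
    rw [this, map_zero]
    exact zero_mem _
  | succ m =>
    obtain ⟨c, rfl⟩ := hg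
    have hf : d p G n f.1 = 0 := f.2
    refine mem_coboundaries_of (m := n + m) (by omega) _ ((-1 : ZMod p) ^ n • cup f.1 c) fun x => ?_
    rw [map_smul, ContinuousMap.smul_apply, d_cup, hf, cupZ_coe, cup_apply]
    simp only [ContinuousMap.zero_apply, zero_mul, zero_add, smul_eq_mul, ← mul_assoc, ← mul_pow]
    simp
    rfl

variable (p G) in
/-- The cohomology class of a cocycle, as a linear map. -/
def mkH (n : ℕ) : cocycles p G n →ₗ[ZMod p] H p G n := (coboundaries p G n).mkQ

theorem mkH_eq_zero {n : ℕ} {f : cocycles p G n} : mkH p G n f = 0 ↔ f ∈ coboundaries p G n :=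
  Submodule.Quotient.mk_eq_zero _

/-- The linear map on cohomology induced by a linear map on cocycles that kills coboundaries. -/
def liftH {n : ℕ} {M : Type*} [AddCommGroup M] [Module (ZMod p) M]
    (φ : cocycles p G n →ₗ[ZMod p] M) (h : coboundaries p G n ≤ LinearMap.ker φ) :
    H p G n →ₗ[ZMod p] M :=
  (coboundaries p G n).liftQ φ h

theorem liftH_mk {n : ℕ} {M : Type*} [AddCommGroup M] [Module (ZMod p) M]
    (φ : cocycles p G n →ₗ[ZMod p] M) (h : coboundaries p G n ≤ LinearMap.ker φ)
    (f : cocycles p G n) : liftH φ h (mkH p G n f) = φ f := rfl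

theorem H_ind {n : ℕ} {P : H p G n → Prop} (h : ∀ f, P (mkH p G n f)) (a : H p G n) : P a :=
  Submodule.Quotient.induction_on _ a h

/-- The cup product on continuous cohomology, induced by the cup product of cocycles. -/
def cupH {n m : ℕ} : H p G n →ₗ[ZMod p] H p G m →ₗ[ZMod p] H p G (n + m) :=
  liftH
    { toFun := fun f => liftH (mkH p G (n + m) ∘ₗ cupZ f)
        fun g hg => LinearMap.mem_ker.2 (mkH_eq_zero.2 (cupZ_mem_right f g hg))
      map_add' := fun f f' => LinearMap.ext fun b => by
        induction b using H_ind with | h g =>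
        simp [liftH_mk]
      map_smul' := fun c f => LinearMap.ext fun b => by
        induction b using H_ind with | h g =>
        simp [liftH_mk] }
    fun f hf => LinearMap.mem_ker.2 (LinearMap.ext fun b => by
      induction b using H_ind with | h g =>
      exact mkH_eq_zero.2 (cupZ_mem_left f g hf))

theorem cupH_mk {n m : ℕ} (f : cocycles p G n) (g : cocycles p G m) :
    cupH (mkH p G n f) (mkH p G m g) = mkH p G (n + m) (cupZ f g) := rfl

/-- The constant `0`-cocycle with value `c`. -/
def constZ : ZMod p →ₗ[ZMod p] cocycles p G 0 where
  toFun c := ⟨ContinuousMap.const _ c, LinearMap.mem_ker.2 (ContinuousMap.ext fun x => by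
    simp [d_apply])⟩
  map_add' _ _ := rfl
  map_smul' _ _ := rfl

theorem constZ_coe_apply (c : ZMod p) (x : Fin 0 → G) : (constZ c : cocycles p G 0).1 x = c := rfl

theorem gradedMk_eq {m n : ℕ} (h : m = n) (f : cocycles p G m) (g : cocycles p G n)
    (hfg : ∀ x : Fin n → G, f.1 (fun i => x (Fin.cast h i)) = g.1 x) :
    GradedMonoid.mk (A := H p G) m (mkH p G m f) = GradedMonoid.mk n (mkH p G n g) := by
  subst h
  congr 2
  exact Subtype.ext (ContinuousMap.ext hfg)

/-- The unit is the class of the constant `0`-cochain `1`. -/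
instance : GradedMonoid.GOne (H p G) := ⟨mkH p G 0 (constZ 1)⟩

/-- Multiplication is the cup product. -/
instance : GradedMonoid.GMul (H p G) := ⟨fun a b => cupH a b⟩

/-- The cup product makes `(Hⁿ(G, 𝔽_p))ₙ` a graded ring. -/
instance : DirectSum.GRing (H p G) where
  mul_zero a := map_zero _
  zero_mul b := by
    show cupH 0 b = 0
    rw [map_zero, LinearMap.zero_apply]
  mul_add a b c := map_add _ _ _
  add_mul a b c := by
    show cupH (a + b) c = cupH a c + cupH b c
    rw [map_add, LinearMap.add_apply]
  one_mul := by
    rintro ⟨n, a⟩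
    induction a using H_ind with | h f =>
    refine gradedMk_eq (zero_add n) (cupZ (constZ 1) f) f fun x => ?_
    rw [cupZ_coe, cup_apply, constZ_coe_apply, one_mul]
    congr 1
    funext i
    exact congrArg x (Fin.ext (by simp))
  mul_one := by
    rintro ⟨n, a⟩
    induction a using H_ind with | h f =>
    refine gradedMk_eq (add_zero n) (cupZ f (constZ 1)) f fun x => ?_
    rw [cupZ_coe, cup_apply, constZ_coe_apply, mul_one]
    rfl
  mul_assoc := by
    rintro ⟨n, a⟩ ⟨m, b⟩ ⟨l, c⟩
    induction a using H_ind with | h f =>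
    induction b using H_ind with | h g =>
    induction c using H_ind with | h e =>
    refine gradedMk_eq (add_assoc n m l) (cupZ (cupZ f g) e) (cupZ f (cupZ g e)) fun x => ?_
    simp only [cupZ_coe, cup_apply, mul_assoc]
    congr 3
    funext i
    exact congrArg x (Fin.ext (by simp [add_assoc]))
  natCast k := mkH p G 0 (constZ (k : ZMod p))
  natCast_zero := by
    rw [Nat.cast_zero, map_zero]
    rfl
  natCast_succ k := by
    rw [Nat.cast_succ, map_add]
    rfl
  intCast k := mkH p G 0 (constZ (k : ZMod p))
  intCast_ofNat k := by rw [Int.cast_natCast]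
  intCast_negSucc_ofNat k := by
    rw [Int.cast_negSucc, map_neg]
    rfl

instance : DirectSum.GAlgebra (ZMod p) (H p G) where
  toFun := (mkH p G 0 ∘ₗ constZ).toAddMonoidHom
  map_one := rfl
  map_mul r s := by
    refine gradedMk_eq (p := p) (G := G) rfl (constZ (r * s)) (cupZ (constZ r) (constZ s)) fun x => ?_
    rfl
  commutes r := by
    rintro ⟨n, a⟩
    induction a using H_ind with | h f =>
    refine gradedMk_eq (by omega) (cupZ (constZ r) f) (cupZ f (constZ r)) fun x => ?_
    simp only [cupZ_coe, cup_apply, constZ_coe_apply]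
    rw [mul_comm]
    congr 2
    funext i
    exact congrArg x (Fin.ext (by simp))
  smul_def r := by
    rintro ⟨n, a⟩
    induction a using H_ind with | h f =>
    refine gradedMk_eq (by omega) (r • f) (cupZ (constZ r) f) fun x => ?_
    simp only [cupZ_coe, cup_apply, constZ_coe_apply]
    show r * f.1 _ = _
    congr 2
    funext i
    exact congrArg x (Fin.ext (by simp))

variable (p G)

/-- The cohomology algebra `H^•(G, 𝔽_p) = ⨁ₙ Hⁿ(G, 𝔽_p)`, with the cup product. -/
abbrev Cohomology : Type u := ⨁ n, H p G n

/-- The degree-`n` part of the cohomology algebra. -/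
def degreePart (n : ℕ) : Submodule (ZMod p) (Cohomology p G) :=
  LinearMap.range (DirectSum.lof (ZMod p) ℕ (H p G) n)

/-- `H^•(G, 𝔽_p)` is graded by its degree parts. -/
instance : GradedAlgebra (degreePart p G) where
  one_mem := ⟨_, rfl⟩
  mul_mem := by
    rintro i j _ _ ⟨a, rfl⟩ ⟨b, rfl⟩
    exact ⟨GradedMonoid.GMul.mul a b, (DirectSum.of_mul_of a b).symm⟩
  decompose' := DirectSum.toModule (ZMod p) ℕ _ fun n =>
    DirectSum.lof (ZMod p) ℕ (fun n => degreePart p G n) n ∘ₗ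
      (DirectSum.lof (ZMod p) ℕ (H p G) n).codRestrict (degreePart p G n) fun a => ⟨a, rfl⟩
  left_inv x := by
    induction x using DirectSum.induction_on with
    | zero => simp
    | of i x =>
      rw [← DirectSum.lof_eq_of (ZMod p), DirectSum.toModule_lof, LinearMap.comp_apply,
        DirectSum.lof_eq_of, DirectSum.coeAddMonoidHom_of]
      rfl
    | add x y hx hy => rw [map_add, map_add, hx, hy]
  right_inv x := by
    induction x using DirectSum.induction_on with
    | zero => simp
    | of i x =>
      obtain ⟨_, a, rfl⟩ := x
      rw [DirectSum.coeAddMonoidHom_of, DirectSum.toModule_lof]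
      rfl
    | add x y hx hy => rw [map_add, map_add, hx, hy]

end Cohomology

end ModPCohomology

namespace Koszul

section Graded

variable {k : Type*} [Field k] {A : Type*} [Ring A] [Algebra k A] (𝒜 : ℕ → Submodule k A)

/-- A graded `k`-algebra is connected if its degree-zero part is a copy of `k`. -/
def IsConnected : Prop :=
  Function.Injective (algebraMap k A) ∧ 𝒜 0 = LinearMap.range (Algebra.linearMap k A)

/-- A graded `k`-algebra is generated in degree one. -/
def IsGeneratedInDegreeOne : Prop := Algebra.adjoin k (𝒜 1 : Set A) = ⊤

/-- The inclusion `V ⊗ V → T(V)` of the degree-two part of the tensor algebra. -/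
noncomputable def tensorSquare (k V : Type*) [Field k] [AddCommGroup V] [Module k V] :
    V ⊗[k] V →ₗ[k] TensorAlgebra k V :=
  LinearMap.mul' k (TensorAlgebra k V) ∘ₗ
    TensorProduct.map (TensorAlgebra.ι k) (TensorAlgebra.ι k)

/-- A graded algebra is quadratic if it is connected, generated in degree one, and
`A = T(V) / ⟨R⟩` for `V = A₁` and some subspace `R ⊆ V ⊗ V`: the kernel of the canonical
homomorphism `T(A₁) → A` (surjective, by generation in degree one) is the two-sided ideal
generated by `R`. -/
structure IsQuadratic : Prop where
  connected : IsConnected 𝒜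
  generated : IsGeneratedInDegreeOne 𝒜
  relations : ∃ R : Submodule k (𝒜 1 ⊗[k] 𝒜 1),
    TwoSidedIdeal.ker (TensorAlgebra.lift k (𝒜 1).subtype) =
      TwoSidedIdeal.span (tensorSquare k (𝒜 1) '' (R : Set (𝒜 1 ⊗[k] 𝒜 1)))

/-- `I ∈ 𝓛(A)`: the left ideal `I` is graded, and generated by its degree-one part. -/
def IsDegreeOneIdeal [GradedAlgebra 𝒜] (I : Ideal A) : Prop :=
  I.IsHomogeneous 𝒜 ∧ I = Ideal.span ((I : Set A) ∩ 𝒜 1)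

/-- The left colon ideal `I : x = {a | a x ∈ I}`. -/
def leftColon (I : Ideal A) (x : A) : Ideal A := Submodule.comap (LinearMap.toSpanSingleton A A x) I

theorem mem_leftColon (I : Ideal A) (x a : A) : a ∈ leftColon I x ↔ a * x ∈ I := Iff.rfl

/-- A universally Koszul algebra: quadratic, with finite-dimensional degree-one part, and such
that for each left ideal `I ∈ 𝓛(A)` and each `x ∈ A₁` outside `I`, also `(I : x) ∈ 𝓛(A)`. -/
structure IsUniversallyKoszul [GradedAlgebra 𝒜] : Prop where
  quadratic : IsQuadratic 𝒜
  finite : FiniteDimensional k (𝒜 1)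
  colon : ∀ I : Ideal A, IsDegreeOneIdeal 𝒜 I → ∀ x ∈ 𝒜 1, x ∉ I →
    IsDegreeOneIdeal 𝒜 (leftColon I x)

/-- The grading of a subalgebra `B` of `A` by the subspaces `B ∩ Aₙ`. -/
def subGrading (B : Subalgebra k A) (n : ℕ) : Submodule k B := (𝒜 n).comap B.val.toLinearMap

/-- A graded subalgebra: a subalgebra that contains the homogeneous components of its elements. -/
structure GradedSubalgebra [GradedAlgebra 𝒜] extends Subalgebra k A where
  isHomogeneous : SetLike.IsHomogeneous 𝒜 toSubalgebra

variable {𝒜} in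
/-- A graded subalgebra is itself a graded algebra. -/
noncomputable instance [GradedAlgebra 𝒜] (B : GradedSubalgebra 𝒜) :
    GradedAlgebra (subGrading 𝒜 B.toSubalgebra) where
  one_mem := SetLike.GradedOne.one_mem (A := 𝒜)
  mul_mem _ _ _ _ ha hb := SetLike.GradedMul.mul_mem (A := 𝒜) ha hb
  toDecomposition := by
    refine DirectSum.IsInternal.chooseDecomposition _ ⟨?_, fun b => ?_⟩
    · let Φ : (⨁ n, subGrading 𝒜 B.toSubalgebra n) →+ ⨁ n, 𝒜 n :=
        DFinsupp.mapRange.addMonoidHom fun n =>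
          (⟨⟨fun b => ⟨b.1.1, b.2⟩, rfl⟩, fun _ _ => rfl⟩ : subGrading 𝒜 B.toSubalgebra n →+ 𝒜 n)
      have hΦ : Function.Injective Φ :=
        (DFinsupp.mapRange_injective _ fun _ => rfl).2 fun n a b h =>
          Subtype.ext (Subtype.ext (congrArg (fun z : 𝒜 n => (z : A)) h))
      have hcomm : (DirectSum.coeAddMonoidHom 𝒜).comp Φ =
          (B.toSubalgebra.val : B.toSubalgebra →+ A).comp
            (DirectSum.coeAddMonoidHom (subGrading 𝒜 B.toSubalgebra)) := by
        refine DirectSum.addHom_ext fun n b => ?_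
        have : Φ (DirectSum.of _ n b) = DirectSum.of (fun n => 𝒜 n) n ⟨b.1.1, b.2⟩ :=
          DFinsupp.mapRange_single (hf := fun _ => rfl)
        rw [AddMonoidHom.comp_apply, this, AddMonoidHom.comp_apply, DirectSum.coeAddMonoidHom_of,
          DirectSum.coeAddMonoidHom_of]
        rfl
      intro x y hxy
      refine hΦ ((DirectSum.Decomposition.isInternal 𝒜).injective ?_)
      have hx := DFunLike.congr_fun hcomm x
      have hy := DFunLike.congr_fun hcomm y
      exact hx.trans ((congrArg Subtype.val hxy).trans hy.symm)
    · classical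
      refine ⟨∑ i ∈ (DirectSum.decompose 𝒜 (b : A)).support, DirectSum.of
        (fun n => subGrading 𝒜 B.toSubalgebra n) i
          ⟨⟨DirectSum.decompose 𝒜 (b : A) i, B.isHomogeneous i b.2⟩, (DirectSum.decompose 𝒜 (b : A) i).2⟩, ?_⟩
      rw [map_sum]
      simp only [DirectSum.coeAddMonoidHom_of]
      refine Subtype.ext ?_
      rw [AddSubmonoidClass.coe_finsetSum]
      exact DirectSum.sum_support_decompose 𝒜 (b : A)

variable {𝒜} in
instance [GradedAlgebra 𝒜] {I : Type*} [Preorder I]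
    (B : I → GradedSubalgebra 𝒜)
    (hB : ∀ i j, i ≤ j → (B i).toSubalgebra ≤ (B j).toSubalgebra) :
    DirectedSystem (fun i => (B i).toSubalgebra)
      (fun i j h => Subalgebra.inclusion (hB i j h)) where
  map_self _ _ := rfl
  map_map _ _ _ _ _ _ := rfl

variable {𝒜} in
/-- The natural map `colim Bᵢ → A` for a directed system of graded subalgebras `Bᵢ` of `A` with
inclusions as transition maps. -/
def colimitMap [GradedAlgebra 𝒜] {I : Type*} [Preorder I] [IsDirectedOrder I]
    (B : I → GradedSubalgebra 𝒜)
    (hB : ∀ i j, i ≤ j → (B i).toSubalgebra ≤ (B j).toSubalgebra) :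
    DirectLimit (fun i => (B i).toSubalgebra) (fun i j h => Subalgebra.inclusion (hB i j h)) → A :=
  DirectLimit.lift _ (fun _ b => (b : A)) fun _ _ _ _ => rfl

end Graded

/-- `A` is asymptotically universally Koszul: it is connected, generated in degree one, and there
is a filtered system `(Bᵢ)` of graded subalgebras which are universally Koszul (so quadratic, with
finite-dimensional degree-one part), such that the natural map `colim Bᵢ → A` is an isomorphism and
each finite-dimensional subspace of `A₁` lies in some `Bᵢ`. -/
def IsAsymptoticallyUniversallyKoszul {k : Type*} [Field k] {A : Type u} [Ring A] [Algebra k A]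
    (𝒜 : ℕ → Submodule k A) [GradedAlgebra 𝒜] : Prop :=
  IsConnected 𝒜 ∧ IsGeneratedInDegreeOne 𝒜 ∧
  ∃ (I : Type u) (_ : Preorder I) (_ : IsDirectedOrder I) (_ : Nonempty I)
    (B : I → GradedSubalgebra 𝒜)
    (hB : ∀ i j, i ≤ j → (B i).toSubalgebra ≤ (B j).toSubalgebra),
    (∀ i, IsUniversallyKoszul (subGrading 𝒜 (B i).toSubalgebra)) ∧
    Function.Bijective (colimitMap B hB) ∧
    ∀ W : Submodule k A, W ≤ 𝒜 1 → FiniteDimensional k W →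
      ∃ i, W ≤ Subalgebra.toSubmodule (B i).toSubalgebra

end Koszul

section FreeProP

/-- A topological group is pro-`p` if it is profinite (compact and totally disconnected) and each
open normal subgroup has index a power of `p`. -/
structure IsProP (p : ℕ) (G : Type*) [Group G] [TopologicalSpace G] [IsTopologicalGroup G] :
    Prop where
  compact : CompactSpace G
  totallyDisconnected : TotallyDisconnectedSpace G
  index : ∀ U : OpenNormalSubgroup G, ∃ n : ℕ, U.toSubgroup.index = p ^ n

/-- A family of elements of a topological group converges to `1` if each neighbourhood of `1`
contains all but finitely many members of the family. -/
def ConvergesToOne {X G : Type*} [Group G] [TopologicalSpace G] (φ : X → G) : Prop :=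
  Tendsto φ cofinite (𝓝 1)

/-- `F` is a free pro-`p` group on `X`, via `ι : X → F`: the family `ι` converges to `1`, and each
family `φ : X → P` in a pro-`p` group `P` that converges to `1` extends to a unique continuous
homomorphism `F → P`. -/
structure IsFreeProP (p : ℕ) {X : Type*} {F : Type u} [Group F] [TopologicalSpace F]
    [IsTopologicalGroup F] (ι : X → F) : Prop where
  isProP : IsProP p F
  convergesToOne : ConvergesToOne ι
  existsUnique_lift : ∀ (P : Type u) [Group P] [TopologicalSpace P] [IsTopologicalGroup P],
    IsProP p P → ∀ φ : X → P, ConvergesToOne φ → ∃! f : F →ₜ* P, ∀ x, f (ι x) = φ x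

end FreeProP

/-! A free pro-`p` group has no continuous mod-`p` cohomology in degrees at least 2, so the algebra
is `k ⊕ A₁` with `A₁ · A₁ = 0`, and the Koszul property of such an algebra is elementary.

Algebra: `k ⊕ A₁` is quadratic with all of `A₁ ⊗ A₁` as relations. If `x ∈ A₁` lies outside a left
ideal `I`, then `(c + v) x = c x` lies in `I` only for `c = 0`, so every relevant colon ideal equals
`A₁`, which is generated in degree one (`mem_leftColon_iff_of_truncated`). The subalgebras `k ⊕ W`,
with `W ⊆ A₁` finite-dimensional, are of the same kind and exhaust `A`.

Vanishing: a cocycle `c` of degree `n + 2` factors through a finite quotient `G = F / U`. In the bar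
resolution of `G` over `𝔽_p`, the pairs `(m, g)` with `∂m = g - 1` form a finite `p`-group that maps
onto `G`. Freeness lifts `F → G` to this group, which yields a derivation `D : F → 𝔽_p[G × G]` with
`∂D(g) = g - 1` (`IsFreeProP.exists_derivation`). Pairing the last two arguments of `c` with `D(g)`
gives a cochain `e(y, g)`, and the cocycle identity turns `de` into `±(c(y, h) - c(y, 1))`
(`d_homotopy`). The term `c(y, 1)` is itself a coboundary (`d_snoc_one`). -/

namespace Koszul

/-! ### Graded algebras concentrated in degrees 0 and 1. -/

section Truncated

variable {k : Type*} [Field k] {A : Type*} [Ring A] [Algebra k A] {𝒜 : ℕ → Submodule k A}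

/-- In a connected graded algebra that vanishes in degrees at least two, each element is the sum of
a scalar and an element of degree one. -/
theorem exists_eq_algebraMap_add [GradedAlgebra 𝒜] (hc : IsConnected 𝒜)
    (h2 : ∀ n, 2 ≤ n → 𝒜 n = ⊥) (a : A) : ∃ c : k, ∃ v ∈ 𝒜 1, a = algebraMap k A c + v := by
  classical
  induction a using DirectSum.Decomposition.inductionOn 𝒜 with
  | zero => exact ⟨0, 0, zero_mem _, by simp⟩
  | @homogeneous i m =>
    obtain ⟨m, hm⟩ := m
    match i, hm with
    | 0, hm =>
      rw [hc.2] at hm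
      obtain ⟨c, rfl⟩ := hm
      exact ⟨c, 0, zero_mem _, by simp⟩
    | 1, hm => exact ⟨0, m, hm, by simp⟩
    | n + 2, hm =>
      rw [h2 _ (by omega), Submodule.mem_bot] at hm
      exact ⟨0, 0, zero_mem _, by simp [hm]⟩
  | add a b ha hb =>
    obtain ⟨c, v, hv, rfl⟩ := ha
    obtain ⟨c', v', hv', rfl⟩ := hb
    exact ⟨c + c', v + v', add_mem hv hv', by rw [map_add]; abel⟩

theorem mul_eq_zero_of_mem_one [GradedAlgebra 𝒜] (h2 : ∀ n, 2 ≤ n → 𝒜 n = ⊥) {v w : A}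
    (hv : v ∈ 𝒜 1) (hw : w ∈ 𝒜 1) : v * w = 0 := by
  have := SetLike.GradedMul.mul_mem hv hw
  rwa [h2 _ (by omega), Submodule.mem_bot] at this

theorem algebraMap_mem_zero [GradedAlgebra 𝒜] (c : k) : algebraMap k A c ∈ 𝒜 0 :=
  SetLike.algebraMap_mem_graded 𝒜 c

theorem eq_zero_of_algebraMap_add_eq_zero [GradedAlgebra 𝒜] (hc : IsConnected 𝒜) {c : k} {v : A}
    (hv : v ∈ 𝒜 1) (h : algebraMap k A c + v = 0) : c = 0 ∧ v = 0 := by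
  have h0 : v = 0 := by
    have h1 := congrArg (fun a => ((DirectSum.decompose 𝒜 a 1 : 𝒜 1) : A)) h
    simp only [DirectSum.decompose_add, DirectSum.add_apply, Submodule.coe_add,
      DirectSum.decompose_of_mem_ne 𝒜 (algebraMap_mem_zero (𝒜 := 𝒜) c) zero_ne_one,
      DirectSum.decompose_of_mem_same 𝒜 hv, DirectSum.decompose_zero, DirectSum.zero_apply,
      ZeroMemClass.coe_zero, zero_add] at h1
    exact h1
  refine ⟨hc.1 ?_, h0⟩
  rw [h0, add_zero] at h
  rw [h, map_zero]

theorem isGeneratedInDegreeOne_of_truncated [GradedAlgebra 𝒜] (hc : IsConnected 𝒜)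
    (h2 : ∀ n, 2 ≤ n → 𝒜 n = ⊥) : IsGeneratedInDegreeOne 𝒜 := by
  refine eq_top_iff.2 fun a _ => ?_
  obtain ⟨c, v, hv, rfl⟩ := exists_eq_algebraMap_add hc h2 a
  exact add_mem (Subalgebra.algebraMap_mem _ c) (Algebra.subset_adjoin hv)

theorem isQuadratic_of_truncated [GradedAlgebra 𝒜] (hc : IsConnected 𝒜)
    (h2 : ∀ n, 2 ≤ n → 𝒜 n = ⊥) : IsQuadratic 𝒜 where
  connected := hc
  generated := isGeneratedInDegreeOne_of_truncated hc h2
  relations := by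
    set J := TwoSidedIdeal.span
      (tensorSquare k (𝒜 1) '' ((⊤ : Submodule k (𝒜 1 ⊗[k] 𝒜 1)) : Set (𝒜 1 ⊗[k] 𝒜 1)))
    have hle : J ≤ TwoSidedIdeal.ker (TensorAlgebra.lift k (𝒜 1).subtype) := by
      refine TwoSidedIdeal.span_le.2 ?_
      rintro _ ⟨r, -, rfl⟩
      rw [SetLike.mem_coe, TwoSidedIdeal.mem_ker]
      induction r with
      | zero => simp
      | tmul v w => simpa [tensorSquare] using mul_eq_zero_of_mem_one h2 v.2 w.2
      | add r s hr hs => rw [map_add, map_add, hr, hs, add_zero]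
    refine ⟨⊤, le_antisymm ?_ ?_⟩
    · have hmul (v w : 𝒜 1) : TensorAlgebra.ι k v * TensorAlgebra.ι k w ∈ J :=
        TwoSidedIdeal.subset_span ⟨v ⊗ₜ w, trivial, by simp [tensorSquare]⟩
      -- Modulo `J` the tensor algebra collapses to `k ⊕ A₁`, on which the map to `A` is injective;
      -- hence the kernel is contained in `J`.
      have key (t : TensorAlgebra k (𝒜 1)) : ∃ (c : k) (v : 𝒜 1),
          t - (algebraMap k _ c + TensorAlgebra.ι k v) ∈ J := by
        induction t using TensorAlgebra.induction with
        | algebraMap c => exact ⟨c, 0, by simp [J.zero_mem]⟩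
        | ι v => exact ⟨0, v, by simp [J.zero_mem]⟩
        | add a b ha hb =>
          obtain ⟨c, v, h⟩ := ha
          obtain ⟨c', v', h'⟩ := hb
          refine ⟨c + c', v + v', ?_⟩
          have := J.add_mem h h'
          rw [map_add, map_add]
          convert this using 1
          abel
        | mul a b ha hb =>
          obtain ⟨c, v, h⟩ := ha
          obtain ⟨c', v', h'⟩ := hb
          refine ⟨c * c', c • v' + c' • v, ?_⟩
          have := J.add_mem (J.add_mem (J.mul_mem_right _ b h)
            (J.mul_mem_left (algebraMap k _ c + TensorAlgebra.ι k v) _ h')) (hmul v v')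
          convert this using 1
          have hcomm := Algebra.commutes c' (TensorAlgebra.ι k v)
          simp only [map_add, map_mul, map_smul, Algebra.smul_def, hcomm]
          noncomm_ring
      intro t ht
      obtain ⟨c, v, h⟩ := key t
      have h0 := (TwoSidedIdeal.mem_ker _).1 (hle h)
      rw [map_sub, (TwoSidedIdeal.mem_ker _).1 ht, zero_sub, neg_eq_zero, map_add, AlgHom.commutes,
        TensorAlgebra.lift_ι_apply] at h0
      obtain ⟨rfl, hv⟩ := eq_zero_of_algebraMap_add_eq_zero hc v.2 h0
      have hv' : v = 0 := Subtype.ext hv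
      rwa [hv', map_zero, map_zero, add_zero, sub_zero] at h
    · exact hle

/-- For `a = c + v` one has `a x = c x`; if `c` were nonzero, dividing by it would put `x` into `I`.
The colon ideal thus depends on neither `I` nor `x`. -/
theorem mem_leftColon_iff_of_truncated [GradedAlgebra 𝒜] (hc : IsConnected 𝒜)
    (h2 : ∀ n, 2 ≤ n → 𝒜 n = ⊥) {I : Ideal A} {x : A} (hx : x ∈ 𝒜 1) (hxI : x ∉ I) (a : A) :
    a ∈ leftColon I x ↔ a ∈ 𝒜 1 := by
  rw [mem_leftColon]
  refine ⟨fun h => ?_, fun h => by rw [mul_eq_zero_of_mem_one h2 h hx]; exact I.zero_mem⟩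
  obtain ⟨c, v, hv, rfl⟩ := exists_eq_algebraMap_add hc h2 a
  rw [add_mul, mul_eq_zero_of_mem_one h2 hv hx, add_zero] at h
  by_cases h0 : c = 0
  · simpa [h0] using hv
  · refine absurd ?_ hxI
    have := I.mul_mem_left (algebraMap k A c⁻¹) h
    rwa [← mul_assoc, ← map_mul, inv_mul_cancel₀ h0, map_one, one_mul] at this

theorem isUniversallyKoszul_of_truncated [GradedAlgebra 𝒜] (hc : IsConnected 𝒜)
    (h2 : ∀ n, 2 ≤ n → 𝒜 n = ⊥) (hfin : FiniteDimensional k (𝒜 1)) : IsUniversallyKoszul 𝒜 where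
  quadratic := isQuadratic_of_truncated hc h2
  finite := hfin
  colon I _ x hx hxI := by
    have hmem := mem_leftColon_iff_of_truncated hc h2 hx hxI
    refine ⟨fun i a ha => ?_, le_antisymm (fun a ha => ?_) ?_⟩
    · rw [hmem] at ha ⊢
      by_cases hi : i = 1
      · subst hi
        exact (DirectSum.decompose 𝒜 a 1).2
      · rw [DirectSum.decompose_of_mem_ne 𝒜 ha (Ne.symm hi)]
        exact zero_mem _
    · exact Ideal.subset_span ⟨ha, (hmem a).1 ha⟩
    · exact Ideal.span_le.2 fun a ha => ha.1

/-- The graded subalgebra `k ⊕ W` of a truncated algebra, for a subspace `W` of its degree-one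
part. -/
def truncatedSubalgebra [GradedAlgebra 𝒜] (h2 : ∀ n, 2 ≤ n → 𝒜 n = ⊥) (W : Submodule k A)
    (hW : W ≤ 𝒜 1) : GradedSubalgebra 𝒜 where
  carrier := {a | ∃ c : k, ∃ w ∈ W, a = algebraMap k A c + w}
  add_mem' := by
    rintro _ _ ⟨c, v, hv, rfl⟩ ⟨c', v', hv', rfl⟩
    exact ⟨c + c', v + v', add_mem hv hv', by rw [map_add]; abel⟩
  mul_mem' := by
    rintro _ _ ⟨c, v, hv, rfl⟩ ⟨c', v', hv', rfl⟩
    refine ⟨c * c', c • v' + c' • v, add_mem (W.smul_mem _ hv') (W.smul_mem _ hv), ?_⟩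
    rw [add_mul, mul_add, mul_add, mul_eq_zero_of_mem_one h2 (hW hv) (hW hv'), map_mul,
      Algebra.smul_def, Algebra.smul_def, ← Algebra.commutes c' v]
    abel
  algebraMap_mem' c := ⟨c, 0, zero_mem _, by simp⟩
  isHomogeneous := by
    rintro i _ ⟨c, w, hw, rfl⟩
    rw [DirectSum.decompose_add, DirectSum.add_apply, Submodule.coe_add]
    match i with
    | 0 =>
      rw [DirectSum.decompose_of_mem_same 𝒜 (algebraMap_mem_zero c),
        DirectSum.decompose_of_mem_ne 𝒜 (hW hw) one_ne_zero]
      exact ⟨c, 0, zero_mem _, rfl⟩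
    | 1 =>
      rw [DirectSum.decompose_of_mem_ne 𝒜 (algebraMap_mem_zero c) zero_ne_one,
        DirectSum.decompose_of_mem_same 𝒜 (hW hw)]
      exact ⟨0, w, hw, by simp⟩
    | n + 2 =>
      rw [DirectSum.decompose_of_mem_ne 𝒜 (algebraMap_mem_zero c) (by omega),
        DirectSum.decompose_of_mem_ne 𝒜 (hW hw) (by omega)]
      exact ⟨0, 0, zero_mem _, by simp⟩

/-- This identifies the degree-one part of `k ⊕ W` with `W`, from which it inherits finite
dimension. -/
theorem mem_of_mem_truncatedSubalgebra [GradedAlgebra 𝒜] (hc : IsConnected 𝒜)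
    {h2 : ∀ n, 2 ≤ n → 𝒜 n = ⊥} {W : Submodule k A} {hW : W ≤ 𝒜 1} {a : A}
    (ha : a ∈ (truncatedSubalgebra h2 W hW).toSubalgebra) (ha1 : a ∈ 𝒜 1) : a ∈ W := by
  obtain ⟨c, w, hw, rfl⟩ := ha
  have h1 : algebraMap k A c ∈ 𝒜 1 := by simpa using sub_mem ha1 (hW hw)
  have h0 := (eq_zero_of_algebraMap_add_eq_zero hc (neg_mem h1)
    (add_neg_cancel (algebraMap k A c))).1
  simpa [h0] using hw

/-- The subalgebra `k ⊕ W` is again connected and zero in degrees at least 2, so the truncated case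
applies to it. -/
theorem isUniversallyKoszul_truncatedSubalgebra [GradedAlgebra 𝒜] (hc : IsConnected 𝒜)
    (h2 : ∀ n, 2 ≤ n → 𝒜 n = ⊥) (W : Submodule k A) (hW : W ≤ 𝒜 1) [FiniteDimensional k W] :
    IsUniversallyKoszul (subGrading 𝒜 (truncatedSubalgebra h2 W hW).toSubalgebra) := by
  refine isUniversallyKoszul_of_truncated ⟨fun c c' h => hc.1 (congrArg Subtype.val h), ?_⟩ ?_ ?_
  · refine le_antisymm ?_ ?_
    · intro b hb
      have hb' : (b : A) ∈ 𝒜 0 := hb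
      rw [hc.2] at hb'
      obtain ⟨c, hb'⟩ := hb'
      exact ⟨c, Subtype.ext hb'⟩
    · rintro _ ⟨c, rfl⟩
      exact algebraMap_mem_zero (𝒜 := 𝒜) c
  · intro n hn
    refine (Submodule.eq_bot_iff _).2 fun b hb => Subtype.ext ?_
    have hb' : (b : A) ∈ 𝒜 n := hb
    rwa [h2 n hn, Submodule.mem_bot] at hb'
  · refine Module.Finite.of_injective (N := W)
      (((truncatedSubalgebra h2 W hW).toSubalgebra.val.toLinearMap.comp
        (Submodule.subtype _)).codRestrict W fun b =>
          mem_of_mem_truncatedSubalgebra hc b.1.2 b.2) fun b b' h => ?_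
    exact Subtype.ext (Subtype.ext (congrArg (fun w : W => (w : A)) h))

end Truncated

/-- A connected graded algebra that vanishes in degrees at least two is asymptotically universally
Koszul. -/
theorem isAsymptoticallyUniversallyKoszul_of_truncated {k : Type*} [Field k] {A : Type u} [Ring A]
    [Algebra k A] {𝒜 : ℕ → Submodule k A} [GradedAlgebra 𝒜] (hc : IsConnected 𝒜)
    (h2 : ∀ n, 2 ≤ n → 𝒜 n = ⊥) : IsAsymptoticallyUniversallyKoszul 𝒜 := by
  let I := {W : Submodule k A // W ≤ 𝒜 1 ∧ FiniteDimensional k W}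
  let B : I → GradedSubalgebra 𝒜 := fun W => truncatedSubalgebra h2 W.1 W.2.1
  have hB (i j : I) (hij : i ≤ j) : (B i).toSubalgebra ≤ (B j).toSubalgebra := by
    rintro _ ⟨c, w, hw, rfl⟩
    exact ⟨c, w, hij hw, rfl⟩
  have hdir : IsDirectedOrder I := ⟨fun V W =>
    have := V.2.2
    have := W.2.2
    ⟨⟨V.1 ⊔ W.1, sup_le V.2.1 W.2.1, Submodule.finiteDimensional_sup _ _⟩, le_sup_left (a := V.1),
      le_sup_right (a := V.1)⟩⟩
  have hne : Nonempty I := ⟨⟨⊥, bot_le, inferInstance⟩⟩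
  refine ⟨hc, isGeneratedInDegreeOne_of_truncated hc h2, I, inferInstance, hdir, hne, B, hB,
    fun W => ?_, ⟨DirectLimit.lift_injective _ _ _ fun _ => Subtype.val_injective, fun a => ?_⟩,
    fun W hW hfin => ⟨⟨W, hW, hfin⟩, fun w hw => ⟨0, w, hw, by simp⟩⟩⟩
  · have := W.2.2
    exact isUniversallyKoszul_truncatedSubalgebra hc h2 W.1 W.2.1
  · obtain ⟨c, v, hv, rfl⟩ := exists_eq_algebraMap_add hc h2 a
    -- A single element `c + v` already lies in `k ⊕ k v`, which gives surjectivity of the colimit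
    -- map.
    let W : I := ⟨k ∙ v, (Submodule.span_singleton_le_iff_mem v _).2 hv, inferInstance⟩
    exact ⟨Quotient.mk _ ⟨W, ⟨_, c, v, Submodule.mem_span_singleton_self v, rfl⟩⟩, rfl⟩

end Koszul

/-! ### Lifting through a finite `p`-group: a Fox-type derivation on a free pro-`p` group. -/

section FoxDerivation

/-- A finite `p`-group with the discrete topology is pro-`p`. -/
theorem IsPGroup.isProP {p : ℕ} [Fact p.Prime] {P : Type*} [Group P] [TopologicalSpace P]
    [DiscreteTopology P] [IsTopologicalGroup P] [Finite P] (h : IsPGroup p P) : IsProP p P where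
  compact := inferInstance
  totallyDisconnected := inferInstance
  index U := h.index U.toSubgroup

/-- The pairing of a function `f` on `G` with the boundary `∑ m(a, b) (ab - a)` of the element
`∑ m(a, b) a[b]` of the degree-one part of the bar resolution of `G` over `𝔽_p`. -/
def barBoundary {p : ℕ} {G : Type*} [Group G] [Fintype G] (m : G → G → Multiplicative (ZMod p))
    (f : G → ZMod p) : ZMod p :=
  ∑ a, ∑ b, (m a b).toAdd * (f (a * b) - f a)

/-- The left component of a product is `m + g · m'` in additive notation, and the boundary is
`G`-equivariant; on functions, the action of `g` becomes translation of `f`. -/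
theorem barBoundary_mul {p : ℕ} {G : Type*} [Group G] [Fintype G]
    (x y : (G → Multiplicative (ZMod p)) ≀ᵣ G) (f : G → ZMod p) :
    barBoundary (x * y).left f =
      barBoundary x.left f + barBoundary y.left fun a => f (x.right * a) := by
  have h : ∑ a, ∑ b, (y.left (x.right⁻¹ * a) b).toAdd * (f (a * b) - f a) =
      ∑ a, ∑ b, (y.left a b).toAdd * (f (x.right * (a * b)) - f (x.right * a)) := by
    refine (Fintype.sum_equiv (Equiv.mulLeft x.right) _ _ fun a => ?_).symm
    simp [mul_assoc]
  simp only [barBoundary, ← h, ← Finset.sum_add_distrib, ← add_mul]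
  rfl

/-- The pairs `(m, g)` of an element `m` of the degree-one part of the bar resolution and an element
`g` of `G` such that `m` has boundary `g - 1`. -/
def barSubgroup (p : ℕ) (G : Type*) [Group G] [Fintype G] :
    Subgroup ((G → Multiplicative (ZMod p)) ≀ᵣ G) where
  carrier := {x | ∀ f, barBoundary x.left f = f x.right - f 1}
  one_mem' f := by simp [barBoundary]
  mul_mem' {x y} hx hy f := by
    -- The boundaries telescope: `(g - 1) + g (h - 1) = gh - 1`.
    rw [barBoundary_mul, hx, hy]
    simp
  inv_mem' {x} hx f := by
    have h := barBoundary_mul x⁻¹ x f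
    rw [inv_mul_cancel, hx] at h
    simp only [RegularWreathProduct.one_left, barBoundary, Pi.one_apply, toAdd_one, zero_mul,
      Finset.sum_const_zero, RegularWreathProduct.inv_right, inv_mul_cancel, mul_one] at h
    simp only [barBoundary, RegularWreathProduct.inv_right]
    linear_combination -h

/-- The chain `1[g]` has boundary `g - 1`, so the projection of the subgroup to `G` is surjective.
-/
theorem exists_mem_barSubgroup (p : ℕ) {G : Type*} [Group G] [Fintype G] (g : G) :
    ∃ x ∈ barSubgroup p G, x.right = g := by
  classical
  refine ⟨⟨Pi.mulSingle 1 (Pi.mulSingle g (Multiplicative.ofAdd 1)), g⟩, fun f => ?_, rfl⟩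
  unfold barBoundary
  rw [Finset.sum_eq_single 1, Finset.sum_eq_single g]
  · simp
  · intro b _ hb
    simp [hb]
  · simp
  · intro a _ ha
    simp [ha]
  · simp

theorem isPGroup_barSubgroup (p : ℕ) [Fact p.Prime] {G : Type*} [Group G] [Fintype G]
    (hG : IsPGroup p G) : IsPGroup p (barSubgroup p G) := by
  refine IsPGroup.to_subgroup ?_ _
  obtain ⟨n, hn⟩ := IsPGroup.iff_card.1 hG
  refine IsPGroup.of_card (n := Nat.card G * Nat.card G + n) ?_
  rw [RegularWreathProduct.card, Nat.card_fun, pow_add, pow_mul, hn]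
  simp

/-- A continuous derivation `D` from a free pro-`p` group `F` to the degree-one part `𝔽_p[G × G]` of
the bar resolution of a finite quotient `G = F / U`, with boundary `D(g) ↦ g - 1`. -/
theorem IsFreeProP.exists_derivation {p : ℕ} [Fact p.Prime] {X : Type*} {F : Type u} [Group F]
    [TopologicalSpace F] [IsTopologicalGroup F] {ι : X → F} (hF : IsFreeProP p ι)
    (U : OpenNormalSubgroup F) [Fintype (F ⧸ U.toSubgroup)] :
    ∃ D : F → F ⧸ U.toSubgroup → F ⧸ U.toSubgroup → ZMod p,
      (∀ a b, Continuous fun g => D g a b) ∧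
      (∀ g h a b, D (g * h) a b = D g a b + D h ((g : F ⧸ U.toSubgroup)⁻¹ * a) b) ∧
      ∀ (g : F) (f : F ⧸ U.toSubgroup → ZMod p),
        ∑ a, ∑ b, D g a b * (f (a * b) - f a) = f g - f 1 := by
  classical
  let G := F ⧸ U.toSubgroup
  have hG : IsPGroup p G := by
    obtain ⟨n, hn⟩ := hF.isProP.index U
    exact IsPGroup.of_card (n := n) hn
  have hU1 : (U : Set F) ∈ 𝓝 (1 : F) := U.toOpenSubgroup.mem_nhds_one
  have : DiscreteTopology G := QuotientGroup.discreteTopology U.toOpenSubgroup.isOpen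
  let K := barSubgroup p G
  let _ : TopologicalSpace K := ⊥
  have : DiscreteTopology K := ⟨rfl⟩
  have hK : IsProP p K := (isPGroup_barSubgroup p hG).isProP
  choose s hs hsr using fun g : G => exists_mem_barSubgroup p g
  -- Generators that die in `G` are sent to `1`. By convergence of `ι` these are all but finitely
  -- many, so `φ` converges to `1`; the chosen lifts `s` alone need not take the value `1` there.
  let φ : X → K := fun x => if (ι x : G) = 1 then 1 else ⟨s (ι x), hs _⟩
  have hφr (x : X) : (φ x).1.right = (ι x : G) := by
    by_cases h : (ι x : G) = 1
    · simp only [φ, if_pos h]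
      exact h.symm
    · simp only [φ, if_neg h, hsr]
  have hφ : ConvergesToOne φ := by
    refine (tendsto_congr' ?_).1 (tendsto_const_nhds (x := (1 : K)))
    filter_upwards [hF.convergesToOne hU1] with x hx
    have : (ι x : G) = 1 := (QuotientGroup.eq_one_iff _).2 hx
    simp only [φ, if_pos this]
  obtain ⟨Φ, hΦ, -⟩ := hF.existsUnique_lift K hK φ hφ
  -- The projection of `Φ` to `G` and the quotient map agree on the generators, so the uniqueness
  -- clause for the target `G` makes them equal.
  have hΦr (g : F) : (Φ g).1.right = (g : G) := by
    let q : F →ₜ* G := ⟨QuotientGroup.mk' U.toSubgroup, continuous_quotient_mk'⟩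
    let r : K →* G := RegularWreathProduct.rightHom.comp K.subtype
    let q' : F →ₜ* G := ⟨r.comp Φ.toMonoidHom, (continuous_of_discreteTopology (f := r)).comp
      Φ.continuous_toFun⟩
    have hq : ConvergesToOne fun x => q (ι x) := by
      have := (q.continuous_toFun.tendsto 1).comp hF.convergesToOne
      rwa [show q.toFun 1 = 1 from map_one q] at this
    obtain ⟨_, -, huniq⟩ := hF.existsUnique_lift G hG.isProP _ hq
    have h : q' = q := (huniq q' fun x => (congrArg (fun k : K => k.1.right) (hΦ x)).trans
      (hφr x)).trans (huniq q fun _ => rfl).symm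
    exact DFunLike.congr_fun h g
  -- `D` is the left component of `Φ`: the derivation law is the wreath product multiplication, and
  -- the boundary condition is membership in `barSubgroup`.
  refine ⟨fun g a b => ((Φ g).1.left a b).toAdd, fun a b => ?_, fun g h a b => ?_, fun g f => ?_⟩
  · exact (continuous_of_discreteTopology (f := fun k : K => (k.1.left a b).toAdd)).comp
      Φ.continuous_toFun
  · simp only [map_mul, ← hΦr g]
    rfl
  · rw [← hΦr g]
    exact (Φ g).2 f

end FoxDerivation

/-! ### Vanishing of cohomology in degrees at least 2. -/

namespace ModPCohomology

section Vanishing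

theorem contractNth_castSucc_castSucc_snoc {α : Type*} (op : α → α → α) {n : ℕ} (j : Fin n)
    (y : Fin (n + 1) → α) (a : α) :
    Fin.contractNth j.castSucc.castSucc op (Fin.snoc y a : Fin (n + 2) → α) =
      Fin.snoc (Fin.contractNth j.castSucc op y) a := by
  ext k
  induction k using Fin.lastCases with
  | last =>
    rw [Fin.snoc_last, Fin.contractNth_apply_of_gt _ _ _ _ (by simp), Fin.succ_last, Fin.snoc_last]
  | cast k =>
    simp only [Fin.snoc_castSucc, Fin.contractNth, Fin.val_castSucc, ← Fin.castSucc_succ]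

theorem contractNth_castSucc_last_snoc {α : Type*} (op : α → α → α) {n : ℕ}
    (y : Fin (n + 1) → α) (a : α) :
    Fin.contractNth (Fin.last n).castSucc op (Fin.snoc y a : Fin (n + 2) → α) =
      Fin.snoc (Fin.init y) (op (y (Fin.last n)) a) := by
  ext k
  induction k using Fin.lastCases with
  | last =>
    rw [Fin.snoc_last, Fin.contractNth_apply_of_eq _ _ _ _ (by simp), Fin.succ_last, Fin.snoc_last,
      Fin.snoc_castSucc]
  | cast k =>
    rw [Fin.contractNth_apply_of_lt _ _ _ _ (by simp), Fin.snoc_castSucc, Fin.snoc_castSucc]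
    rfl

theorem contractNth_last_snoc {α : Type*} (op : α → α → α) {n : ℕ} (y : Fin n → α) (a : α) :
    Fin.contractNth (Fin.last n) op (Fin.snoc y a : Fin (n + 1) → α) = y := by
  ext k
  rw [Fin.contractNth_apply_of_lt _ _ _ _ (by simp), Fin.snoc_castSucc]

variable {p : ℕ} {F : Type u} [Group F] [TopologicalSpace F] [IsTopologicalGroup F]

/-- The homotopy acts on the final arguments, so the summands of the differential are sorted by
whether they touch the last argument; `d_snoc_snoc` does the same for the last two. -/
theorem d_snoc {n : ℕ} (f : Cochain p F (n + 1)) (y : Fin (n + 1) → F) (h : F) :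
    d p F (n + 1) f (Fin.snoc y h) = f (Fin.snoc (Fin.tail y) h) +
      ∑ j : Fin n, (-1 : ZMod p) ^ ((j : ℕ) + 1) *
        f (Fin.snoc (Fin.contractNth j.castSucc (· * ·) y) h) +
      (-1) ^ (n + 1) * f (Fin.snoc (Fin.init y) (y (Fin.last n) * h)) + (-1) ^ (n + 2) * f y := by
  have h0 : (fun i : Fin (n + 1) => (Fin.snoc y h : Fin (n + 2) → F) i.succ) =
      Fin.snoc (Fin.tail y) h := by
    ext k
    induction k using Fin.lastCases with
    | last => rw [Fin.succ_last, Fin.snoc_last, Fin.snoc_last]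
    | cast k => rw [Fin.succ_castSucc, Fin.snoc_castSucc, Fin.snoc_castSucc]; rfl
  rw [d_apply, h0, Fin.sum_univ_castSucc, Fin.sum_univ_castSucc, contractNth_last_snoc,
    contractNth_castSucc_last_snoc]
  simp only [contractNth_castSucc_castSucc_snoc, Fin.val_castSucc, Fin.val_last]
  ring

theorem tail_snoc {α : Type*} {n : ℕ} (y : Fin (n + 1) → α) (a : α) :
    Fin.tail (Fin.snoc y a : Fin (n + 2) → α) = (Fin.snoc (Fin.tail y) a : Fin (n + 1) → α) := by
  ext k
  induction k using Fin.lastCases with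
  | last => rw [Fin.tail, Fin.succ_last, Fin.snoc_last, Fin.snoc_last]
  | cast k => rw [Fin.tail, Fin.succ_castSucc, Fin.snoc_castSucc, Fin.snoc_castSucc]; rfl

theorem d_snoc_snoc {n : ℕ} (f : Cochain p F (n + 2)) (y : Fin (n + 1) → F) (a b : F) :
    d p F (n + 2) f (Fin.snoc (Fin.snoc y a : Fin (n + 2) → F) b) =
      f (Fin.snoc (Fin.snoc (Fin.tail y) a : Fin (n + 1) → F) b) +
      ∑ j : Fin n, (-1 : ZMod p) ^ ((j : ℕ) + 1) *
        f (Fin.snoc (Fin.snoc (Fin.contractNth j.castSucc (· * ·) y) a : Fin (n + 1) → F) b) +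
      (-1) ^ (n + 1) *
        f (Fin.snoc (Fin.snoc (Fin.init y) (y (Fin.last n) * a) : Fin (n + 1) → F) b) +
      (-1) ^ (n + 2) * f (Fin.snoc y (a * b)) + (-1) ^ (n + 3) * f (Fin.snoc y a) := by
  rw [d_snoc, Fin.sum_univ_castSucc, tail_snoc, contractNth_castSucc_last_snoc, Fin.init_snoc,
    Fin.snoc_last]
  simp only [contractNth_castSucc_castSucc_snoc, Fin.val_castSucc, Fin.val_last]
  ring

/-- A locally constant function on a power of a profinite group is invariant under an open normal
subgroup. -/
theorem exists_openNormalSubgroup_factor [CompactSpace F] [TotallyDisconnectedSpace F] {n : ℕ}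
    (c : Cochain p F n) : ∃ U : OpenNormalSubgroup F, ∀ x y : Fin n → F,
      (∀ i, (x i : F ⧸ U.toSubgroup) = y i) → c x = c y := by
  -- Each point has a neighbourhood on which this holds for `u` near `1`; compactness makes the
  -- neighbourhood of `1` uniform in `x`.
  have hev : ∀ᶠ u in 𝓝 (1 : Fin n → F), ∀ x ∈ (Set.univ : Set (Fin n → F)), c x = c (x * u) := by
    refine isCompact_univ.eventually_forall_of_forall_eventually fun x _ => ?_
    have hcont : Continuous fun z : (Fin n → F) × (Fin n → F) => (c z.2, c (z.2 * z.1)) := by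
      fun_prop
    exact ((isOpen_discrete {q : ZMod p × ZMod p | q.1 = q.2}).preimage hcont).mem_nhds (by simp)
  rw [nhds_pi, Filter.eventually_iff, Filter.mem_pi] at hev
  obtain ⟨I, -, t, ht, hsub⟩ := hev
  -- There are finitely many coordinates, so the intersection of all `t i` is still a neighbourhood
  -- of `1` and one subgroup serves for all of them.
  obtain ⟨V, hV, hVo, h1V⟩ := mem_nhds_iff.1 ((Filter.iInter_mem (s := t)).2 ht)
  obtain ⟨U, hU⟩ := ProfiniteGrp.exist_openNormalSubgroup_sub_open_nhds_of_one hVo h1V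
  refine ⟨U, fun x y hxy => ?_⟩
  have hmem : x⁻¹ * y ∈ I.pi t := fun i _ =>
    Set.mem_iInter.1 (hV (hU (QuotientGroup.eq.1 (hxy i)))) i
  have := hsub hmem x trivial
  rwa [mul_inv_cancel_left] at this

/-- The cochain homotopy attached to a derivation `D` as in `IsFreeProP.exists_derivation`. -/
theorem d_homotopy {U : Subgroup F} [U.Normal] [Fintype (F ⧸ U)] {n : ℕ} (c : Cochain p F (n + 2))
    (hc : d p F (n + 2) c = 0)
    (hU : ∀ x y : Fin (n + 2) → F, (∀ i, (x i : F ⧸ U) = y i) → c x = c y)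
    (D : F → F ⧸ U → F ⧸ U → ZMod p)
    (hmul : ∀ g h a b, D (g * h) a b = D g a b + D h ((g : F ⧸ U)⁻¹ * a) b)
    (hbd : ∀ (g : F) (f : F ⧸ U → ZMod p),
      ∑ a, ∑ b, D g a b * (f (a * b) - f a) = f g - f 1)
    (e : Cochain p F (n + 1))
    (he : ∀ y g, e (Fin.snoc y g) = ∑ a, ∑ b, D g a b *
      c (Fin.snoc (Fin.snoc y a.out : Fin (n + 1) → F) b.out))
    (y : Fin (n + 1) → F) (h : F) :
    d p F (n + 1) e (Fin.snoc y h) =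
      (-1) ^ (n + 1) * (c (Fin.snoc y h) - c (Fin.snoc y 1)) := by
  -- These two facts allow a product of representatives `out` to be replaced by the representative
  -- of the product.
  have hsnoc1 (z : Fin (n + 1) → F) (s t : F) (hst : (s : F ⧸ U) = t) :
      c (Fin.snoc z s) = c (Fin.snoc z t) := by
    refine hU _ _ fun i => ?_
    induction i using Fin.lastCases with
    | last => simpa using hst
    | cast i => simp
  have hsnoc2 (z : Fin n → F) (s t r : F) (hst : (s : F ⧸ U) = t) :
      c (Fin.snoc (Fin.snoc z s : Fin (n + 1) → F) r) =
        c (Fin.snoc (Fin.snoc z t : Fin (n + 1) → F) r) := by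
    refine hU _ _ fun i => ?_
    induction i using Fin.lastCases with
    | last => simp
    | cast i =>
      induction i using Fin.lastCases with
      | last => simpa using hst
      | cast i => simp
  -- The boundary condition `∂D(h) = h - 1`, tested on the function `c(y, ·)` on `G`.
  have hbd' : c (Fin.snoc y h) - c (Fin.snoc y 1) =
      ∑ a : F ⧸ U, ∑ b : F ⧸ U, D h a b *
        (c (Fin.snoc y (a.out * b.out)) - c (Fin.snoc y a.out)) := by
    rw [hsnoc1 y h (h : F ⧸ U).out (by simp), hsnoc1 y 1 (1 : F ⧸ U).out (by simp),
      ← hbd h fun a => c (Fin.snoc y a.out)]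
    refine Finset.sum_congr rfl fun a _ => Finset.sum_congr rfl fun b _ => ?_
    rw [hsnoc1 y (a * b).out (a.out * b.out) (by simp)]
  -- The derivation law splits off `e y`, which cancels against the last summand of `de`, where it
  -- occurs with the opposite sign.
  have hder : e (Fin.snoc (Fin.init y) (y (Fin.last n) * h)) = e y + ∑ a : F ⧸ U, ∑ b : F ⧸ U,
      D h a b * c (Fin.snoc (Fin.snoc (Fin.init y) (y (Fin.last n) * a.out) : Fin (n + 1) → F)
        b.out) := by
    conv_rhs => rw [← Fin.snoc_init_self y]
    rw [he, he]
    simp only [hmul, add_mul, Finset.sum_add_distrib, Fin.init_snoc, Fin.snoc_last]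
    congr 1
    refine (Fintype.sum_equiv (Equiv.mulLeft (y (Fin.last n) : F ⧸ U)) _ _ fun a => ?_).symm
    refine Finset.sum_congr rfl fun b _ => ?_
    simp only [Equiv.coe_mulLeft, inv_mul_cancel_left]
    rw [hsnoc2 _ (y (Fin.last n) * a.out) ((y (Fin.last n) : F ⧸ U) * a).out _ (by simp)]
  -- Pairing with `D h` is linear, so it can be applied term by term to the cocycle identity at `(y,
  -- a, b)`, read as an identity between functions of `(a, b)`.
  let T : (F ⧸ U → F ⧸ U → ZMod p) →ₗ[ZMod p] ZMod p :=
    ∑ a, ∑ b, D h a b • (LinearMap.proj (φ := fun _ => ZMod p) b ∘ₗ LinearMap.proj a)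
  have hT (φ : F ⧸ U → F ⧸ U → ZMod p) : T φ = ∑ a, ∑ b, D h a b * φ a b := by
    simp [T, LinearMap.sum_apply]
  let c₂ (s : F) (z : Fin n → F) : F ⧸ U → F ⧸ U → ZMod p := fun a b =>
    c (Fin.snoc (Fin.snoc z (s * a.out) : Fin (n + 1) → F) b.out)
  let c₁ : F ⧸ U → F ⧸ U → ZMod p := fun a b =>
    c (Fin.snoc y (a.out * b.out)) - c (Fin.snoc y a.out)
  have hdc : c₂ 1 (Fin.tail y) +
      ∑ j : Fin n, (-1 : ZMod p) ^ ((j : ℕ) + 1) •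
        c₂ 1 (Fin.contractNth j.castSucc (· * ·) y) +
      (-1 : ZMod p) ^ (n + 1) • c₂ (y (Fin.last n)) (Fin.init y) +
      (-1 : ZMod p) ^ (n + 2) • c₁ = 0 := by
    ext a b
    have := congrArg (fun f => f (Fin.snoc (Fin.snoc y a.out : Fin (n + 2) → F) b.out)) hc
    simp only [d_snoc_snoc, ContinuousMap.zero_apply] at this
    simp only [Pi.add_apply, Finset.sum_apply, Pi.smul_apply, smul_eq_mul, Pi.zero_apply, c₁, c₂,
      one_mul]
    linear_combination this
  have hsum := congrArg T hdc
  simp only [map_add, map_sum, map_smul, map_zero, smul_eq_mul] at hsum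
  simp only [hT, c₁, c₂, one_mul] at hsum
  rw [d_snoc, hder, hbd']
  simp only [he]
  linear_combination hsum

/-- In the cocycle identity at `(y, h, 1)` the last two summands are both `c(y, h)`, with opposite
signs. The others are the summands of `de` except the final one, which therefore is all that
remains. -/
theorem d_snoc_one {n : ℕ} (c : Cochain p F (n + 2)) (hc : d p F (n + 2) c = 0)
    (e : Cochain p F (n + 1)) (he : ∀ y, e y = c (Fin.snoc y 1)) (y : Fin (n + 1) → F) (h : F) :
    d p F (n + 1) e (Fin.snoc y h) = (-1) ^ n * c (Fin.snoc y 1) := by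
  have := congrArg (fun f => f (Fin.snoc (Fin.snoc y h : Fin (n + 2) → F) 1)) hc
  simp only [d_snoc_snoc, ContinuousMap.zero_apply, mul_one] at this
  rw [d_snoc]
  simp only [he]
  linear_combination this

theorem exists_d_eq_of_isFreeProP [Fact p.Prime] {X : Type*} {ι : X → F} (hF : IsFreeProP p ι) {n : ℕ}
    (c : Cochain p F (n + 2)) (hc : d p F (n + 2) c = 0) :
    ∃ e : Cochain p F (n + 1), d p F (n + 1) e = c := by
  have := hF.isProP.compact
  have := hF.isProP.totallyDisconnected
  obtain ⟨U, hU⟩ := exists_openNormalSubgroup_factor c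
  have : Finite (F ⧸ U.toSubgroup) := Subgroup.quotient_finite_of_isOpen _ U.isOpen'
  have := Fintype.ofFinite (F ⧸ U.toSubgroup)
  obtain ⟨D, hcont, hmul, hbd⟩ := hF.exists_derivation U
  let e : Cochain p F (n + 1) :=
    { toFun := fun x => ∑ a, ∑ b, D (x (Fin.last n)) a b *
        c (Fin.snoc (Fin.snoc (Fin.init x) a.out : Fin (n + 1) → F) b.out)
      continuous_toFun := by
        refine continuous_finsetSum _ fun a _ => continuous_finsetSum _ fun b _ => ?_
        refine ((hcont a b).comp (continuous_apply _)).mul (c.continuous.comp ?_)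
        refine Continuous.finSnoc (Continuous.finSnoc ?_ continuous_const) continuous_const
        exact continuous_pi fun i => continuous_apply _ }
  let e₁ : Cochain p F (n + 1) :=
    { toFun := fun x => c (Fin.snoc x 1)
      continuous_toFun := c.continuous.comp (Continuous.finSnoc continuous_id continuous_const) }
  -- Here `de = (-1)^(n+1) (c(y, h) - c(y, 1))` and `de₁ = (-1)^n c(y, 1)`, so the `c(y, 1)` terms
  -- cancel in `d(e - e₁)` and only the sign must be undone.
  refine ⟨(-1 : ZMod p) ^ (n + 1) • (e - e₁), ContinuousMap.ext fun x => ?_⟩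
  rw [← Fin.snoc_init_self x, map_smul, map_sub, ContinuousMap.smul_apply,
    ContinuousMap.sub_apply, d_homotopy c hc hU D hmul hbd e (fun y g => by simp [e]),
    d_snoc_one c hc e₁ fun _ => rfl, smul_eq_mul]
  have hsq : ((-1 : ZMod p) ^ n) ^ 2 = 1 := by rw [← pow_mul, mul_comm, pow_mul, neg_one_sq, one_pow]
  rw [pow_succ]
  linear_combination c (Fin.snoc (Fin.init x) (x (Fin.last (n + 1))) : Fin (n + 2) → F) * hsq

theorem degreePart_eq_bot_of_isFreeProP [Fact p.Prime] {X : Type*} {ι : X → F} (hF : IsFreeProP p ι)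
    (n : ℕ) (hn : 2 ≤ n) : degreePart p F n = ⊥ := by
  obtain ⟨n, rfl⟩ := Nat.exists_eq_add_of_le' hn
  rw [degreePart, LinearMap.range_eq_bot]
  ext1 a
  induction a using H_ind with | h c =>
  obtain ⟨e, he⟩ := exists_d_eq_of_isFreeProP hF c.1 c.2
  have h0 : mkH p F (n + 2) c = 0 := mkH_eq_zero.2 ⟨e, Subtype.ext he⟩
  rw [h0, map_zero, map_zero]

/-- `Fin 0 → F` is a single point, so 0-cochains are constants, and the coboundaries in degree 0 are
zero by definition. -/
theorem isConnected_degreePart [Fact p.Prime] : Koszul.IsConnected (degreePart p F) := by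
  have halg (r : ZMod p) : algebraMap (ZMod p) (Cohomology p F) r =
      DirectSum.lof (ZMod p) ℕ (H p F) 0 (mkH p F 0 (constZ r)) := rfl
  refine ⟨(injective_iff_map_eq_zero _).2 fun r hr => ?_, le_antisymm ?_ ?_⟩
  · rw [halg, ← map_zero (DirectSum.lof (ZMod p) ℕ (H p F) 0)] at hr
    have h0 : constZ (G := F) r ∈ coboundaries p F 0 :=
      mkH_eq_zero.1 (DirectSum.of_injective 0 hr)
    have h1 : constZ (G := F) r = 0 := h0
    exact congrArg (fun f : cocycles p F 0 => f.1 default) h1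
  · rintro _ ⟨a, rfl⟩
    induction a using H_ind with | h f =>
    refine ⟨f.1 default, ?_⟩
    rw [Algebra.linearMap_apply, halg]
    congr 2
    exact Subtype.ext (ContinuousMap.ext fun x => congrArg f.1 (Subsingleton.elim _ _))
  · rintro _ ⟨r, rfl⟩
    exact ⟨_, (halg r).symm⟩

end Vanishing

end ModPCohomology

theorem mainTheorem3 (p : ℕ) [Fact p.Prime] {X : Type*} {F : Type u} [Group F]
    [TopologicalSpace F] [IsTopologicalGroup F] (ι : X → F) (hF : IsFreeProP p ι) :
    Koszul.IsAsymptoticallyUniversallyKoszul (ModPCohomology.degreePart p F) :=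
  Koszul.isAsymptoticallyUniversallyKoszul_of_truncated ModPCohomology.isConnected_degreePart
    (ModPCohomology.degreePart_eq_bot_of_isFreeProP hF)
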